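/- A metrizable space $X$ is an ANR (absolute neighbourhood retract) if, whenever $X$ is embedded as a closed subspace of a metrizable space $Y$, there is an open neighbourhood of $X$ in $Y$ that retracts onto $X$. A continuous map is a fibration (in the sense of Hurewicz) if it has the homotopy lifting property with respect to every topological space. For a continuous map $f\colon X\to Y$ and a subset $A\subseteq Y$, a local homotopy section of $f$ on $A$ is a continuous map $s\colon A\to X$ such that $f\circ s$ is homotopic to the inclusion $A\hookrightarrow Y$. The sectional category $\operatorname{secat}(f)$ is the least integer $n\ge 0$ such that $Y$ can be covered by $n+1$ open subsets, on each of which $f$ has a local homotopy section; it is $\infty$ if no such $n$ exists. The generalized sectional category $\operatorname{secat}_g(f)$ is defined in the same way, with coverings of $Y$ by $n+1$ arbitrary (not necessarily open) subsets. **Theorem.** Let $p\colon E\to B$ be a fibration, where $E$ and $B$ are ANR spaces. Then $$\operatorname{secat}(p)=\operatorname{secat}_g(p).$$ -/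

import Mathlib

universe u v

/-- A topological space `X` is an absolute neighbourhood retract (ANR) if it is metrizable and,
whenever `X` is embedded as a closed subspace of a metrizable space `Y`, some open neighbourhood
of (the image of) `X` in `Y` retracts onto `X`. -/
def IsANR (X : Type u) [TopologicalSpace X] : Prop :=
  TopologicalSpace.MetrizableSpace X ∧
    ∀ (Y : Type u) [TopologicalSpace Y] [TopologicalSpace.MetrizableSpace Y] (i : X → Y),
      Topology.IsClosedEmbedding i →
        ∃ U : Set Y, IsOpen U ∧ Set.range i ⊆ U ∧
          ∃ r : C(U, X), ∀ (x : X) (hx : i x ∈ U), r ⟨i x, hx⟩ = x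

/-- `p : E → B` is a (Hurewicz) fibration: it has the homotopy lifting property with respect to
every topological space `Z`. (The universe of `Z` contains the universal test space
`{(e, γ) ∈ E × B^I | γ 0 = p e}`, so larger test spaces add nothing.) -/
def IsHurewiczFibration {E : Type u} {B : Type v} [TopologicalSpace E] [TopologicalSpace B]
    (p : C(E, B)) : Prop :=
  ∀ (Z : Type (max u v)) [TopologicalSpace Z] (h : C(Z, E)) (H : C(Z × unitInterval, B)),
    (∀ z, H (z, 0) = p (h z)) →
      ∃ G : C(Z × unitInterval, E), (∀ z, G (z, 0) = h z) ∧ ∀ w, p (G w) = H w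

/-- The map `f : X → Y` has a local homotopy section on the subset `A` of `Y`: a continuous map
`s : A → X` such that `f ∘ s` is homotopic, as a map `A → Y`, to the inclusion `A ↪ Y`. -/
def HasLocalHomotopySection {X : Type u} {Y : Type v} [TopologicalSpace X] [TopologicalSpace Y]
    (f : C(X, Y)) (A : Set Y) : Prop :=
  ∃ s : C(A, X), (f.comp s).Homotopic (⟨Subtype.val, continuous_subtype_val⟩ : C(A, Y))

/-- The sectional category of `f : X → Y`: the least `n : ℕ` such that `Y` is covered by `n + 1`
open subsets on each of which `f` has a local homotopy section, and `∞` if there is no such `n`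
(the infimum of the empty family in `ℕ∞` is `⊤`). -/
noncomputable def secat {X : Type u} {Y : Type v} [TopologicalSpace X] [TopologicalSpace Y]
    (f : C(X, Y)) : ℕ∞ :=
  ⨅ n ∈ {n : ℕ | ∃ U : Fin (n + 1) → Set Y,
    (∀ i, IsOpen (U i)) ∧ (⋃ i, U i) = Set.univ ∧ ∀ i, HasLocalHomotopySection f (U i)}, (n : ℕ∞)

/-- The generalized sectional category of `f : X → Y`: the least `n : ℕ` such that `Y` is covered
by `n + 1` arbitrary subsets on each of which `f` has a local homotopy section, and `∞` if there
is no such `n`. -/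
noncomputable def secatGen {X : Type u} {Y : Type v} [TopologicalSpace X] [TopologicalSpace Y]
    (f : C(X, Y)) : ℕ∞ :=
  ⨅ n ∈ {n : ℕ | ∃ A : Fin (n + 1) → Set Y,
    (⋃ i, A i) = Set.univ ∧ ∀ i, HasLocalHomotopySection f (A i)}, (n : ℕ∞)

open Topology Set

/-! Lifting turns a homotopy section on an arbitrary `A` into a strict section `s`, so it is enough
to spread `s`, up to homotopy, over an open neighbourhood of `A`. Kuratowski embeddings make `E` and
`B` retracts of neighbourhoods in the convex hulls of their images, where averages and segments are
available. Near `A`, values of `s` at nearby points of `A` are averaged by a partition of unity and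
retracted to `E`, giving `f`. Then `p (f x)` and `x` lie in a common small convex set, and the
segment between them, retracted to `B`, is the homotopy. -/

/-- Kuratowski's isometric embedding of a pointed metric space into the space of its bounded
continuous functions, `x ↦ dist x · - dist x₀ ·`. -/
noncomputable def boundedDistEmbedding {X : Type u} [MetricSpace X] (x₀ x : X) :
    BoundedContinuousFunction X ℝ :=
  BoundedContinuousFunction.ofNormedAddCommGroup (fun y => dist x y - dist x₀ y)
    (by fun_prop) (dist x x₀) (fun y => by
      rw [Real.norm_eq_abs]
      exact abs_dist_sub_le x x₀ y)

theorem boundedDistEmbedding_apply {X : Type u} [MetricSpace X] (x₀ x y : X) :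
    boundedDistEmbedding x₀ x y = dist x y - dist x₀ y := rfl

theorem isometry_boundedDistEmbedding {X : Type u} [MetricSpace X] (x₀ : X) :
    Isometry (boundedDistEmbedding x₀) := by
  refine Isometry.of_dist_eq fun x z => le_antisymm ?_ ?_
  · refine (BoundedContinuousFunction.dist_le dist_nonneg).2 fun y => ?_
    rw [boundedDistEmbedding_apply, boundedDistEmbedding_apply, dist_sub_right, Real.dist_eq]
    exact abs_dist_sub_le x z y
  · have h := BoundedContinuousFunction.dist_coe_le_dist (f := boundedDistEmbedding x₀ x)
      (g := boundedDistEmbedding x₀ z) z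
    rw [boundedDistEmbedding_apply, boundedDistEmbedding_apply, dist_sub_right, dist_self,
      Real.dist_eq, sub_zero, abs_of_nonneg dist_nonneg] at h
    exact h

/-- A point of the convex hull of the image which is a limit of image points is an image point:
a metric space is closed in the convex hull of its Kuratowski embedding. -/
theorem mem_range_boundedDistEmbedding {X : Type u} [MetricSpace X] (x₀ : X)
    {g : BoundedContinuousFunction X ℝ}
    (hg : g ∈ convexHull ℝ (range (boundedDistEmbedding x₀)))
    (hcl : g ∈ closure (range (boundedDistEmbedding x₀))) :
    g ∈ range (boundedDistEmbedding x₀) := by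
  obtain ⟨ι, _, w, z, hw0, hw1, hz, rfl⟩ := mem_convexHull_iff_exists_fintype.1 hg
  choose x hx using hz
  obtain ⟨k, -, hk⟩ : ∃ k ∈ Finset.univ, 0 < w k :=
    Finset.exists_lt_of_sum_lt (s := Finset.univ) (f := fun _ => (0 : ℝ)) (by simp [hw1])
  refine ⟨x k, dist_le_zero.1 (le_of_forall_pos_le_add fun ε hε => ?_)⟩
  obtain ⟨_, ⟨y, rfl⟩, hy⟩ := Metric.mem_closure_iff.1 hcl (min (ε / 2) (w k * (ε / 2)))
    (lt_min (by positivity) (by positivity))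
  -- Evaluation at `y` itself turns sup-norm closeness into a bound on the weighted mean of the
  -- `dist (x i) y`, hence on `dist (x k) y` since `w k > 0`. The index `k` does not depend on `ε`.
  have hval : dist ((∑ i, w i • z i) y) (boundedDistEmbedding x₀ y y) =
      ∑ i, w i * dist (x i) y := by
    have h1 : (∑ i, w i • z i) y = ∑ i, w i * dist (x i) y - dist x₀ y := by
      rw [BoundedContinuousFunction.coe_sum, Finset.sum_apply]
      simp only [← hx, BoundedContinuousFunction.coe_smul, boundedDistEmbedding_apply, smul_eq_mul,
        mul_sub, Finset.sum_sub_distrib, ← Finset.sum_mul, hw1, one_mul]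
    rw [h1, boundedDistEmbedding_apply, dist_sub_right, dist_self, Real.dist_eq, sub_zero,
      abs_of_nonneg]
    exact Finset.sum_nonneg fun i _ => mul_nonneg (hw0 i) dist_nonneg
  have h2 : w k * dist (x k) y ≤ ∑ i, w i * dist (x i) y :=
    Finset.single_le_sum (f := fun i => w i * dist (x i) y)
      (fun i _ => mul_nonneg (hw0 i) dist_nonneg) (Finset.mem_univ k)
  have h3 : w k * dist (x k) y < w k * (ε / 2) :=
    h2.trans_lt (hval ▸ (BoundedContinuousFunction.dist_coe_le_dist y).trans_lt
      (hy.trans_le (min_le_right _ _)))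
  have h4 : dist (x k) y < ε / 2 := lt_of_mul_lt_mul_left h3 hk.le
  have h5 := dist_triangle_right (boundedDistEmbedding x₀ (x k)) (∑ i, w i • z i)
    (boundedDistEmbedding x₀ y)
  rw [(isometry_boundedDistEmbedding x₀).dist_eq] at h5
  linarith [hy.trans_le (min_le_left _ _)]

/-- A nonempty ANR embeds into a normed space so that it is a retract of a neighbourhood of its
image within the convex hull of that image. -/
theorem IsANR.exists_retraction_convexHull {X : Type u} [TopologicalSpace X] [Nonempty X]
    (hX : IsANR X) :
    ∃ (N : Type u) (_ : NormedAddCommGroup N) (_ : NormedSpace ℝ N) (j : C(X, N)) (O : Set N)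
      (r : C(↥(O ∩ convexHull ℝ (range j)), X)), IsOpen O ∧ (∀ x, j x ∈ O) ∧
        ∀ x hx, r ⟨j x, hx⟩ = x := by
  obtain ⟨_, hX⟩ := hX
  let _ := TopologicalSpace.metrizableSpaceMetric X
  let x₀ : X := Classical.arbitrary X
  let j := boundedDistEmbedding x₀
  have hj : Isometry j := isometry_boundedDistEmbedding x₀
  let K := convexHull ℝ (range j)
  have hjK : ∀ x, j x ∈ K := fun x => subset_convexHull ℝ _ ⟨x, rfl⟩
  have hemb : IsEmbedding (codRestrict j K hjK) := hj.isEmbedding.codRestrict K hjK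
  have hcl : IsClosed (range (codRestrict j K hjK)) := by
    refine isClosed_of_closure_subset fun g hg => ?_
    have hg' : (g : BoundedContinuousFunction X ℝ) ∈ closure (range j) := by
      refine closure_mono ?_ (image_closure_subset_closure_image continuous_subtype_val
        (mem_image_of_mem _ hg))
      rintro _ ⟨_, ⟨x, rfl⟩, rfl⟩
      exact ⟨x, rfl⟩
    obtain ⟨x, hx⟩ := mem_range_boundedDistEmbedding x₀ g.2 hg'
    exact ⟨x, Subtype.ext hx⟩
  obtain ⟨U, hU, hXU, r, hr⟩ := hX K _ ⟨hemb, hcl⟩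
  obtain ⟨O, hO, rfl⟩ := isOpen_induced_iff.1 hU
  refine ⟨BoundedContinuousFunction X ℝ, inferInstance, inferInstance, ⟨j, hj.continuous⟩, O,
    r.comp ⟨fun y => ⟨⟨y, y.2.2⟩, y.2.1⟩, by fun_prop⟩, hO, fun x => hXU ⟨x, rfl⟩, ?_⟩
  intro x hx
  exact hr x hx.1

/-- A homotopy section of a fibration may be deformed into a strict section. -/
theorem HasLocalHomotopySection.exists_section {E : Type u} {B : Type v} [TopologicalSpace E]
    [TopologicalSpace B] {p : C(E, B)} (hp : IsHurewiczFibration p) {A : Set B}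
    (hA : HasLocalHomotopySection p A) : ∃ s : C(A, E), ∀ a, p (s a) = a := by
  obtain ⟨s, ⟨F⟩⟩ := hA
  obtain ⟨G, -, hG⟩ := hp (ULift.{u} A) ⟨fun z => s z.down, by fun_prop⟩
    ⟨fun w => F (w.2, w.1.down), by fun_prop⟩ (fun z => by simp)
  refine ⟨⟨fun a => G (ULift.up a, 1), by fun_prop⟩, fun a => ?_⟩
  have := hG (ULift.up a, 1)
  simpa using this

/-- A map between ANRs that has a section on a subset has a homotopy section on a neighbourhood of
that subset. -/
theorem exists_isOpen_hasLocalHomotopySection {E : Type u} {B : Type v} [TopologicalSpace E]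
    [TopologicalSpace B] (hE : IsANR E) (hB : IsANR B) (p : C(E, B)) {A : Set B}
    (s : C(A, E)) (hs : ∀ a, p (s a) = a) :
    ∃ U : Set B, IsOpen U ∧ A ⊆ U ∧ HasLocalHomotopySection p U := by
  rcases A.eq_empty_or_nonempty with rfl | ⟨a₀, ha₀⟩
  · exact ⟨∅, isOpen_empty, subset_rfl, s, ⟨(ContinuousMap.Homotopy.refl _).cast rfl
      (by ext x; exact x.2.elim)⟩⟩
  have _ : Nonempty E := ⟨s ⟨a₀, ha₀⟩⟩
  have _ : Nonempty B := ⟨a₀⟩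
  obtain ⟨N, _, _, i, O, r, hO, hiO, hr⟩ := hE.exists_retraction_convexHull
  obtain ⟨M, _, _, j, P, q, hP, hjP, hq⟩ := hB.exists_retraction_convexHull
  have _ := hB.1
  let _ := TopologicalSpace.metrizableSpaceMetric B
  have hi : ∀ x, i x ∈ convexHull ℝ (range i) := fun x => subset_convexHull ℝ _ ⟨x, rfl⟩
  have hj : ∀ x, j x ∈ convexHull ℝ (range j) := fun x => subset_convexHull ℝ _ ⟨x, rfl⟩
  -- The radius is doubled for `s` because two balls through a common point have centres at most two
  -- larger radii apart.
  have key : ∀ a : A, ∃ (n : ℕ) (C : Set N) (D : Set M), Convex ℝ C ∧ Convex ℝ D ∧ C ⊆ O ∧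
      D ⊆ P ∧ (∀ a' : A, dist (a' : B) a < 2 * (1 / 2) ^ n → i (s a') ∈ C) ∧
      (∀ x, dist x (a : B) < (1 / 2) ^ n → j x ∈ D) ∧
      ∀ y : ↥(O ∩ convexHull ℝ (range i)), (y : N) ∈ C → j (p (r y)) ∈ D := by
    intro a
    obtain ⟨η, hη, hηP⟩ := Metric.isOpen_iff.1 hP (j a) (hjP a)
    have hD : Metric.ball (j a) η ∈ 𝓝 (j a) := Metric.ball_mem_nhds _ hη
    let y₀ : ↥(O ∩ convexHull ℝ (range i)) := ⟨i (s a), hiO _, hi _⟩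
    have hy₀ : j (p (r y₀)) = j a := by rw [show r y₀ = s a from hr _ _, hs]
    have h1 : ∀ᶠ y in 𝓝 y₀, j (p (r y)) ∈ Metric.ball (j a) η := by
      have hc : Continuous fun y => j (p (r y)) := by fun_prop
      exact hc.continuousAt.eventually (hy₀ ▸ hD)
    rw [nhds_subtype, Filter.eventually_comap] at h1
    obtain ⟨ε, hε, hεO⟩ := Metric.mem_nhds_iff.1 (Filter.inter_mem h1 (hO.mem_nhds (hiO (s a))))
    have h2 : ∀ᶠ a' in 𝓝 a, i (s a') ∈ Metric.ball (i (s a)) ε :=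
      (i.comp s).continuous.continuousAt.eventually (Metric.ball_mem_nhds _ hε)
    have h3 : ∀ᶠ x in 𝓝 (a : B), j x ∈ Metric.ball (j a) η := j.continuous.continuousAt hD
    obtain ⟨δ₁, hδ₁, H1⟩ := Metric.eventually_nhds_iff.1 h2
    obtain ⟨δ₂, hδ₂, H2⟩ := Metric.eventually_nhds_iff.1 h3
    obtain ⟨n, hn⟩ := exists_pow_lt_of_lt_one (lt_min (half_pos hδ₁) hδ₂)
      (by norm_num : (1 / 2 : ℝ) < 1)
    refine ⟨n, Metric.ball (i (s a)) ε, Metric.ball (j a) η, convex_ball _ _, convex_ball _ _,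
      fun y hy => (hεO hy).2, hηP, fun a' ha' => H1 ?_, fun x hx => H2 ?_,
      fun y hy => (hεO hy).1 y rfl⟩
    · have := hn.trans_le (min_le_left _ _)
      rw [Subtype.dist_eq]
      linarith
    · exact hx.trans (hn.trans_le (min_le_right _ _))
  choose n C D hC hD hCO hDP hsC hjD hrD using key
  let U : Set B := ⋃ a : A, Metric.ball (a : B) ((1 / 2) ^ n a)
  have hU : IsOpen U := isOpen_iUnion fun _ => Metric.isOpen_ball
  let S : U → Set A := fun x => {a | (x : B) ∈ Metric.ball (a : B) ((1 / 2) ^ n a)}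
  let t : U → Set N := fun x => convexHull ℝ ((fun a => i (s a)) '' S x)
  have hSne : ∀ x, (S x).Nonempty := fun x => mem_iUnion.1 x.2
  obtain ⟨g, hg⟩ : ∃ g : C(U, N), ∀ x, g x ∈ t x := by
    -- Membership in the ball around `a` is an open condition, so the constant `i (s a)` is a local
    -- selection.
    refine exists_continuous_forall_mem_convex_of_local_const (fun x => convex_convexHull ℝ _) ?_
    intro x
    obtain ⟨a, ha⟩ := hSne x
    refine ⟨i (s a), ?_⟩
    filter_upwards [(Metric.isOpen_ball.preimage continuous_subtype_val).mem_nhds ha] with y hy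
    exact subset_convexHull ℝ _ ⟨a, hy, rfl⟩
  have htC : ∀ x, ∃ a ∈ S x, t x ⊆ C a := by
    intro x
    -- Least `n a` means the largest ball containing `x`; every other centre in `S x` is then within
    -- twice its radius of `a`, so one convex set `C a` contains all of `t x`.
    obtain ⟨a, ha, hmin⟩ := WellFounded.has_min (measure n).wf (S x) (hSne x)
    refine ⟨a, ha, convexHull_min ?_ (hC a)⟩
    rintro _ ⟨a', ha', rfl⟩
    refine hsC a a' ?_
    have h1 : n a ≤ n a' := not_lt.1 (hmin a' ha')
    have h2 : ((1 : ℝ) / 2) ^ n a' ≤ (1 / 2) ^ n a :=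
      pow_le_pow_of_le_one (by norm_num) (by norm_num) h1
    have h3 : dist (x : B) a < (1 / 2) ^ n a := ha
    have h4 : dist (x : B) a' < (1 / 2) ^ n a' := ha'
    linarith [dist_triangle_left (a' : B) a x]
  have hgO : ∀ x, g x ∈ O ∩ convexHull ℝ (range i) := by
    intro x
    obtain ⟨a, -, ha⟩ := htC x
    refine ⟨hCO a (ha (hg x)), convexHull_mono ?_ (hg x)⟩
    rintro _ ⟨a', -, rfl⟩
    exact ⟨_, rfl⟩
  let f : C(U, E) := r.comp ⟨fun x => ⟨g x, hgO x⟩, by fun_prop⟩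
  have hseg : ∀ w : unitInterval × U,
      AffineMap.lineMap (j (p (f w.2))) (j w.2) (w.1 : ℝ) ∈ P ∩ convexHull ℝ (range j) := by
    rintro ⟨τ, x⟩
    obtain ⟨a, hax, ha⟩ := htC x
    exact ⟨hDP a ((hD a).lineMap_mem (hrD a ⟨g x, hgO x⟩ (ha (hg x))) (hjD a x hax) τ.2),
      (convex_convexHull ℝ _).lineMap_mem (hj _) (hj _) τ.2⟩
  have hcont : Continuous fun w : unitInterval × U =>
      AffineMap.lineMap (k := ℝ) (j (p (f w.2))) (j w.2) (w.1 : ℝ) := by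
    simp only [AffineMap.lineMap_apply_module]
    fun_prop
  -- A free `y` lets the endpoints of the segment be rewritten despite the membership proof
  -- depending on them.
  have hend : ∀ (y : M) (hy) (b : B), y = j b → q ⟨y, hy⟩ = b := by
    rintro _ hy b rfl
    exact hq b hy
  refine ⟨U, hU, fun a ha => mem_iUnion.2 ⟨⟨a, ha⟩, Metric.mem_ball_self (by positivity)⟩, f, ⟨{
    toFun := fun w => q ⟨_, hseg w⟩
    continuous_toFun := q.continuous.comp (hcont.subtype_mk _)
    map_zero_left := fun x => hend _ _ _ (by simp)
    map_one_left := fun x => hend _ _ _ (by simp) }⟩⟩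

theorem mainTheorem1 {E : Type u} {B : Type v} [TopologicalSpace E] [TopologicalSpace B]
    (hE : IsANR E) (hB : IsANR B) (p : C(E, B)) (hp : IsHurewiczFibration p) :
    secat p = secatGen p := by
  unfold secat secatGen
  congr! 5
  ext n
  constructor
  · rintro ⟨U, -, hU, h⟩
    exact ⟨U, hU, h⟩
  · rintro ⟨A, hA, h⟩
    have key : ∀ i, ∃ U : Set B, IsOpen U ∧ A i ⊆ U ∧ HasLocalHomotopySection p U := fun i => by
      obtain ⟨s, hs⟩ := (h i).exists_section hp
      exact exists_isOpen_hasLocalHomotopySection hE hB p s hs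
    choose U hU hAU hsec using key
    exact ⟨U, hU, univ_subset_iff.1 (hA ▸ iUnion_mono hAU), hsec⟩
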